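/- Let $L\ge 8$ and $q\ge 2$ be integers, and let $\Lambda$ be one of the following two finite graphs: (i) the periodic square lattice of side $L$, with vertex set $(\mathbb{Z}/L)^2$ and $x$ adjacent to $x\pm(1,0)$ and $x\pm(0,1)$; (ii) the periodic hexagonal lattice of side $L$, with $2L^2$ vertices, that is, the graph whose vertices are the triangular faces of the rhombus-shaped triangular lattice of side length $L$ with opposite sides identified, two vertices being adjacent when the corresponding triangles share a side. Let $\Omega=\{1,\dots,q\}$ and $\mathcal{X}=\Omega^{\Lambda}$, and define $$H(\sigma)=\sum_{\{x,y\}\text{ edge of }\Lambda}\mathbf{1}\{\sigma(x)\ne\sigma(y)\},\qquad \sigma\in\mathcal{X}.$$ A path is a finite sequence $(\omega_n)_{n=0}^N$ in $\mathcal{X}$ ($N\ge 0$) such that, for each $0\le n<N$, $\omega_{n+1}$ is obtained from $\omega_n$ by changing the spin at exactly one site. It connects $\sigma$ and $\zeta$ if its two endpoints are $\sigma$ and $\zeta$, in either order. For $\sigma,\zeta\in\mathcal{X}$ let $$\Phi(\sigma,\zeta)=\min_{(\omega_n)_{n=0}^N\text{ connects }\sigma\text{ and }\zeta}\ \max_{0\le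 n\le N}H(\omega_n).$$ For $a\in\Omega$ let $\mathbf{a}\in\mathcal{X}$ be the configuration all of whose spins are $a$, and let $\mathcal{S}=\{\mathbf{1},\dots,\mathbf{q}\}$ be the set of ground states. Then, for each of the two lattices, the energy barrier between any two distinct ground states $\mathbf{a}\ne\mathbf{b}$ is $$\Gamma=\Phi(\mathbf{a},\mathbf{b})=2L+2.$$ Moreover, $$\min_{\mathbf{s}\in\mathcal{S}}\Phi(\sigma,\mathbf{s})-H(\sigma)<\Gamma=2L+2\qquad\text{for all }\sigma\in\mathcal{X}\setminus\mathcal{S}.$$ -/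

import Mathlib

namespace PottsTorus

/-- The `L × L` square lattice with periodic boundary conditions: sites are elements of
`(ℤ/L)²`, and `x` is joined to `x ± (1,0)` and `x ± (0,1)`. -/
def squareLattice (L : ℕ) : SimpleGraph (ZMod L × ZMod L) :=
  SimpleGraph.fromRel fun x y => y = x + (1, 0) ∨ y = x + (0, 1)

/-- Sites of the periodic hexagonal lattice of side `L`, seen as the triangular faces of the dual
lattice. The dual lattice is a rhombus-shaped triangular lattice, spanned by two unit vectors
`e₁, e₂` at angle `π/3`, whose opposite sides are identified. Its cell `(i, j)` (with corners
`p, p + e₁, p + e₂, p + e₁ + e₂` for `p = i e₁ + j e₂`) is the union of the triangle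
`p, p + e₁, p + e₂`, which is the site `((i, j), false)`, and of the triangle
`p + e₁, p + e₂, p + e₁ + e₂`, which is the site `((i, j), true)`. There are `2 L²` sites. -/
abbrev HexSite (L : ℕ) : Type := (ZMod L × ZMod L) × Bool

/-- The periodic hexagonal lattice of side `L`: two sites are joined when the corresponding
triangles share a side. The triangle `(p, true)` shares its three sides with the triangles
`(p, false)`, `(p + (1,0), false)` and `(p + (0,1), false)`. -/
def hexLattice (L : ℕ) : SimpleGraph (HexSite L) :=
  SimpleGraph.fromRel fun x y => x.2 = true ∧ y.2 = false ∧
    (y.1 = x.1 ∨ y.1 = x.1 + (1, 0) ∨ y.1 = x.1 + (0, 1))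

instance (L : ℕ) : DecidableRel (squareLattice L).Adj := by
  unfold squareLattice; infer_instance

instance (L : ℕ) : DecidableRel (hexLattice L).Adj := by
  unfold hexLattice; infer_instance

/-- Spin configurations on the site set `V`, with `q` possible spins. -/
abbrev Config (V : Type) (q : ℕ) : Type := V → Fin q

section

variable {V : Type} {q : ℕ}

/-- The Ising/Potts Hamiltonian without external field: the sum over the (unordered) edges
`{x, y}` of the lattice of the indicator of `σ x ≠ σ y`. -/
def hamiltonian [Fintype V] [DecidableEq V] (G : SimpleGraph V) [DecidableRel G.Adj]
    (σ : Config V q) : ℕ :=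
  ∑ e ∈ G.edgeFinset, if (e.map σ).IsDiag then 0 else 1

/-- `ζ` is obtained from `σ` by changing the spin at exactly one site. -/
def SpinFlip [DecidableEq V] (σ ζ : Config V q) : Prop :=
  ∃ (x : V) (a : Fin q), ζ = Function.update σ x a ∧ ζ ≠ σ

/-- `ω 0, …, ω N` is a path of length `N`: consecutive configurations differ by a single spin
flip. (The values of `ω` beyond `N` are irrelevant.) -/
def IsPath [DecidableEq V] (N : ℕ) (ω : ℕ → Config V q) : Prop :=
  ∀ n < N, SpinFlip (ω n) (ω (n + 1))

/-- The path `ω 0, …, ω N` connects `σ` and `ζ`. -/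
def Connects (N : ℕ) (ω : ℕ → Config V q) (σ ζ : Config V q) : Prop :=
  (ω 0 = σ ∧ ω N = ζ) ∨ (ω 0 = ζ ∧ ω N = σ)

/-- The maximal energy along `ω 0, …, ω N`. -/
def pathHeight [Fintype V] [DecidableEq V] (G : SimpleGraph V) [DecidableRel G.Adj]
    (N : ℕ) (ω : ℕ → Config V q) : ℕ :=
  (Finset.range (N + 1)).sup' Finset.nonempty_range_add_one fun n => hamiltonian G (ω n)

/-- All the maximal energies of the paths that connect `σ` and `ζ`. -/
def pathHeights [Fintype V] [DecidableEq V] (G : SimpleGraph V) [DecidableRel G.Adj]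
    (σ ζ : Config V q) : Set ℕ :=
  {h | ∃ (N : ℕ) (ω : ℕ → Config V q), IsPath N ω ∧ Connects N ω σ ζ ∧ pathHeight G N ω = h}

/-- The communication height `Φ(σ, ζ)`: the minimum, over the paths that connect `σ` and `ζ`, of
the maximal energy along the path. The set of natural numbers on the right is nonempty
(`pathHeights_nonempty` below), so that `sInf` is its minimum. -/
noncomputable def commHeight [Fintype V] [DecidableEq V] (G : SimpleGraph V) [DecidableRel G.Adj]
    (σ ζ : Config V q) : ℕ :=
  sInf (pathHeights G σ ζ)

/-- The ground state all of whose spins are `a`. -/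
def ground (V : Type) {q : ℕ} (a : Fin q) : Config V q := fun _ => a

/-- The set of the ground states. -/
def groundStates (V : Type) (q : ℕ) : Set (Config V q) := Set.range (ground V)

/-- The minimum of `Φ(σ, s)` over `s ∈ A` (for nonempty `A`). -/
noncomputable def commHeightSet [Fintype V] [DecidableEq V] (G : SimpleGraph V)
    [DecidableRel G.Adj] (σ : Config V q) (A : Set (Config V q)) : ℕ :=
  sInf (commHeight G σ '' A)

theorem exists_path [Fintype V] [DecidableEq V] (σ ζ : Config V q) :
    ∃ (N : ℕ) (ω : ℕ → Config V q), IsPath N ω ∧ ω 0 = σ ∧ ω N = ζ := by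
  suffices h : ∀ s : Finset V, ∃ (N : ℕ) (ω : ℕ → Config V q),
      IsPath N ω ∧ ω 0 = σ ∧ ω N = s.piecewise ζ σ by
    simpa using h Finset.univ
  intro s
  induction s using Finset.induction_on with
  | empty => exact ⟨0, fun _ => σ, fun n hn => absurd hn (Nat.not_lt_zero n), rfl, by simp⟩
  | insert x s hx ih =>
    obtain ⟨N, ω, hω, h0, hN⟩ := ih
    by_cases hEq : (insert x s).piecewise ζ σ = s.piecewise ζ σ
    · exact ⟨N, ω, hω, h0, hN.trans hEq.symm⟩
    · refine ⟨N + 1, fun n => if n ≤ N then ω n else (insert x s).piecewise ζ σ, ?_, ?_, ?_⟩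
      · intro n hn
        rcases Nat.lt_or_ge n N with h | h
        · have h1 : n ≤ N := h.le
          have h2 : n + 1 ≤ N := h
          simpa [h1, h2] using hω n h
        · have h1 : n = N := by omega
          subst h1
          simp only [le_refl, if_true, Nat.not_succ_le_self, if_false, hN]
          exact ⟨x, ζ x, Finset.piecewise_insert s ζ σ x, hEq⟩
      · simpa using h0
      · simp

/-- Any two configurations are connected by a path. -/
theorem pathHeights_nonempty [Fintype V] [DecidableEq V] (G : SimpleGraph V) [DecidableRel G.Adj]
    (σ ζ : Config V q) : (pathHeights G σ ζ).Nonempty := by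
  obtain ⟨N, ω, hω, h0, hN⟩ := exists_path σ ζ
  exact ⟨_, N, ω, hω, Or.inl ⟨h0, hN⟩, rfl⟩

end

end PottsTorus

/-! Upper bounds: overwrite a configuration by one spin, site by site in lexicographic order. The
energy grows by at most the cut of the swept set, and that cut never exceeds 2L+2
(`lexicographic_cut_le`, `hexRank_cut_le`). From a non-ground configuration, start the sweep at an
edge where the spins disagree: once both ends are swept, its cost is saved, and until then the cut
is below 2L+2. Hence the strict inequality; `barrier_of_sweep_of_cut` assembles this.

Lower bound: the number of sites with the target spin passes through every value, in particular a
chosen k near half the sites, and every cut of size k has at least 2L+2 edges (`square_energy_ge`,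
`hex_energy_ge`). Indeed, a closed line of sites that meets both colours contributes at least 2.
With too few edges there are few mixed lines, and the constant lines confine one colour to crossings
of mixed lines, too few for a set near half. Non-divisibility of k excludes a family of lines
without a mixed member. On the hexagonal lattice the lines are strips of triangles in three
directions, each edge lying in two strips, and parity supplies the last unit. -/

namespace PottsTorus

/-! ### Edge cuts and overwriting -/

section Energy

variable {V ι : Type} {α : Type*} [Fintype ι] [DecidableEq α]

/-- The number of edges, indexed by `ι` with ends `s` and `t`, across which `σ` is not constant. -/
def energy (s t : ι → V) (σ : V → α) : ℕ := ∑ e, if σ (s e) = σ (t e) then 0 else 1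

theorem hamiltonian_eq_energy [Fintype V] [DecidableEq V] {q : ℕ} {G : SimpleGraph V}
    [DecidableRel G.Adj] {s t : ι → V} (hinj : Function.Injective fun e => s(s e, t e))
    (hadj : ∀ x y, G.Adj x y ↔ ∃ e, s(s e, t e) = s(x, y)) (σ : Config V q) :
    hamiltonian G σ = energy s t σ := by
  have h : G.edgeFinset = Finset.univ.map ⟨fun e => s(s e, t e), hinj⟩ := by
    ext z
    induction z with
    | _ x y => simp [hadj]
  simp [hamiltonian, h, energy]

/-- Merging spins creates no disagreement; this reduces the Potts energy to the cut of a single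
colour class. -/
theorem energy_comp_le {β : Type*} [DecidableEq β] (s t : ι → V) (σ : V → α) (g : α → β) :
    energy s t (fun x => g (σ x)) ≤ energy s t σ := by
  refine Finset.sum_le_sum fun e _ => ?_
  by_cases h : σ (s e) = σ (t e)
  · simp [h]
  · simp only [h, if_false]
    split_ifs <;> simp

theorem energy_const (s t : ι → V) (a : α) : energy s t (fun _ => a) = 0 := by
  simp [energy]

/-- Edges inside `A` become free, edges outside are untouched, and boundary edges cost at most 1,
already paid by the cut of `A`. -/
theorem energy_overwrite_le (s t : ι → V) (σ : V → α) (b : α) (A : V → Bool) :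
    energy s t (fun x => if A x then b else σ x) ≤ energy s t σ + energy s t A := by
  unfold energy
  rw [← Finset.sum_add_distrib]
  refine Finset.sum_le_sum fun e _ => ?_
  cases h1 : A (s e) <;> cases h2 : A (t e) <;> simp [h1, h2] <;> split_ifs <;> simp

/-- Overwriting both ends of an edge across which `σ` varies saves one unit of energy. -/
theorem energy_overwrite_lt (s t : ι → V) (σ : V → α) (b : α) (A : V → Bool) (e₀ : ι)
    (hs : A (s e₀) = true) (ht : A (t e₀) = true) (hne : σ (s e₀) ≠ σ (t e₀)) :
    energy s t (fun x => if A x then b else σ x) < energy s t σ + energy s t A := by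
  unfold energy
  rw [← Finset.sum_add_distrib]
  refine Finset.sum_lt_sum (fun e _ => ?_) ⟨e₀, Finset.mem_univ _, by simp [hs, ht, hne]⟩
  cases h1 : A (s e) <;> cases h2 : A (t e) <;> simp [h1, h2] <;> split_ifs <;> simp

end Energy

/-! ### Paths, sweeps and communication heights -/

section Paths

variable {V : Type} {q : ℕ} [Fintype V] [DecidableEq V] (G : SimpleGraph V) [DecidableRel G.Adj]

/-- Some path from `σ` to `ζ` has energies at most `h`. -/
def ReachableBelow (h : ℕ) (σ ζ : Config V q) : Prop :=
  ∃ (N : ℕ) (ω : ℕ → Config V q), IsPath N ω ∧ ω 0 = σ ∧ ω N = ζ ∧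
    ∀ n ≤ N, hamiltonian G (ω n) ≤ h

variable {G}

theorem ReachableBelow.refl {h : ℕ} {σ : Config V q} (hσ : hamiltonian G σ ≤ h) :
    ReachableBelow G h σ σ :=
  ⟨0, fun _ => σ, fun n hn => absurd hn (Nat.not_lt_zero n), rfl, rfl, fun _ _ => hσ⟩

theorem ReachableBelow.update {h : ℕ} {σ ζ : Config V q} (hr : ReachableBelow G h σ ζ) (x : V)
    (a : Fin q) (hH : hamiltonian G (Function.update ζ x a) ≤ h) :
    ReachableBelow G h σ (Function.update ζ x a) := by
  -- A spin flip must change the configuration, so a trivial update may not lengthen the path.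
  by_cases heq : Function.update ζ x a = ζ
  · rwa [heq]
  obtain ⟨N, ω, hω, h0, hN, hle⟩ := hr
  refine ⟨N + 1, fun n => if n ≤ N then ω n else Function.update ζ x a, ?_, by simpa using h0,
    by simp, ?_⟩
  · intro n hn
    rcases Nat.lt_or_ge n N with hlt | hge
    · have h1 : n ≤ N := hlt.le
      have h2 : n + 1 ≤ N := hlt
      simpa [h1, h2] using hω n hlt
    · obtain rfl : n = N := by omega
      simp only [le_refl, if_true, Nat.not_succ_le_self, if_false, hN]
      exact ⟨x, a, rfl, heq⟩
  · intro n _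
    dsimp only
    split_ifs with h1
    · exact hle n h1
    · exact hH

theorem ReachableBelow.commHeight_le {h : ℕ} {σ ζ : Config V q} (hr : ReachableBelow G h σ ζ) :
    commHeight G σ ζ ≤ h := by
  obtain ⟨N, ω, hω, h0, hN, hle⟩ := hr
  have hmem : pathHeight G N ω ∈ pathHeights G σ ζ := ⟨N, ω, hω, Or.inl ⟨h0, hN⟩, rfl⟩
  refine (Nat.sInf_le hmem).trans ?_
  exact Finset.sup'_le _ _ fun n hn => hle n (by simpa [Nat.lt_succ_iff] using hn)

/-- Overwrite `σ` by `b`, one site at a time in the order given by `r`. -/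
theorem reachableBelow_sweep {r : V → ℕ} (hr : Function.Injective r) {h : ℕ} {σ : Config V q}
    (b : Fin q) (hh : ∀ k, hamiltonian G (fun x => if decide (r x < k) then b else σ x) ≤ h) :
    ReachableBelow G h σ (ground V b) := by
  have key : ∀ k, ReachableBelow G h σ (fun x => if decide (r x < k) then b else σ x) := by
    intro k
    induction k with
    | zero => simpa using ReachableBelow.refl (G := G) (by simpa using hh 0)
    | succ k ih =>
      -- Ranks need not be consecutive: a value that is not attained changes nothing.
      by_cases hx : ∃ x, r x = k
      · obtain ⟨x, rfl⟩ := hx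
        have he : (fun y => if decide (r y < r x + 1) then b else σ y)
            = Function.update (fun y => if decide (r y < r x) then b else σ y) x b := by
          ext1 y
          by_cases hyx : y = x
          · subst hyx; simp
          · have : r y ≠ r x := fun hc => hyx (hr hc)
            have h2 : r y < r x + 1 ↔ r y < r x := by omega
            simp [hyx, h2]
        rw [he]
        exact ih.update x b (he ▸ hh _)
      · have he : (fun y => if decide (r y < k + 1) then b else σ y)
            = fun y => if decide (r y < k) then b else σ y := by
          ext1 y
          have : r y ≠ k := fun hc => hx ⟨y, hc⟩
          have h2 : r y < k + 1 ↔ r y < k := by omega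
          simp [h2]
        rwa [he]
  have hM := key ((Finset.univ.sup r) + 1)
  have he : (fun x => if decide (r x < Finset.univ.sup r + 1) then b else σ x) = ground V b := by
    ext1 x
    have : r x ≤ Finset.univ.sup r := Finset.le_sup (Finset.mem_univ x)
    simp [ground, this]
  rwa [he] at hM

theorem exists_eq_of_step_le_one {c : ℕ → ℕ} {N k : ℕ} (h0 : c 0 ≤ k) (hN : k ≤ c N)
    (hstep : ∀ n < N, c (n + 1) ≤ c n + 1) : ∃ n ≤ N, c n = k := by
  induction N with
  | zero => exact ⟨0, le_rfl, le_antisymm h0 hN⟩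
  | succ N ih =>
    by_cases hk : k ≤ c N
    · obtain ⟨n, hn, rfl⟩ := ih hk fun n hn => hstep n (by omega)
      exact ⟨n, by omega, rfl⟩
    · exact ⟨N + 1, le_rfl, by have := hstep N (by omega); omega⟩

/-- The count of the final spin starts at 0, ends at `Fintype.card V` and rises by at most one per
flip, so it equals `k` at some time. -/
theorem le_commHeight_ground {h k : ℕ} (hk : k ≤ Fintype.card V)
    (hiso : ∀ (σ : Config V q) (b : Fin q),
      (Finset.univ.filter fun x => σ x = b).card = k → h ≤ hamiltonian G σ)
    {a b : Fin q} (hab : a ≠ b) : h ≤ commHeight G (ground V a) (ground V b) := by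
  have key : ∀ (N : ℕ) (ω : ℕ → Config V q) (a b : Fin q), a ≠ b → IsPath N ω →
      ω 0 = ground V a → ω N = ground V b → h ≤ pathHeight G N ω := by
    intro N ω a b hab hω h0 hN
    obtain ⟨n, hn, hc⟩ := exists_eq_of_step_le_one
      (c := fun n => (Finset.univ.filter fun x => ω n x = b).card) (k := k) (N := N)
      (by simp [h0, ground, hab]) (by simpa [hN, ground] using hk) (by
        intro n hn
        obtain ⟨x, c, hx, -⟩ := hω n hn
        refine (Finset.card_le_card (t := insert x (Finset.univ.filter fun x => ω n x = b))
          ?_).trans (Finset.card_insert_le _ _)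
        intro y hy
        by_cases hyx : y = x
        · simp [hyx]
        · simpa [hx, hyx] using hy)
    exact (hiso _ b hc).trans (Finset.le_sup' (fun n => hamiltonian G (ω n))
      (Finset.mem_range.2 (Nat.lt_succ_of_le hn)))
  refine le_csInf (pathHeights_nonempty G _ _) ?_
  rintro _ ⟨N, ω, hω, ⟨h0, hN⟩ | ⟨h0, hN⟩, rfl⟩
  · exact key N ω a b hab hω h0 hN
  · exact key N ω b a hab.symm hω h0 hN

end Paths

/-! ### From sweeps and cuts to the barrier -/

section Barrier

variable {V ι : Type} {q : ℕ} [Fintype V] [DecidableEq V] [Fintype ι] {G : SimpleGraph V}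
  [DecidableRel G.Adj] {s t : ι → V}

/-- The barrier is `Γ` and all the other wells are shallower, provided that the cuts of size `k`
have at least `Γ` edges, and that for each edge `e` some order of the sites has initial segments
whose cuts have at most `Γ` edges, with strict inequality as long as `e` has not been swept. -/
theorem barrier_of_sweep_of_cut {Γ k : ℕ}
    (hH : ∀ σ : Config V q, hamiltonian G σ = energy s t σ)
    (hconst : ∀ σ : Config V q, (∀ e, σ (s e) = σ (t e)) → ∀ x y, σ x = σ y)
    [Nonempty V] [Nonempty ι] (hk : k ≤ Fintype.card V)
    (hcut : ∀ A : V → Bool, (Finset.univ.filter fun x => A x = true).card = k →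
      Γ ≤ energy s t A)
    (hsweep : ∀ e : ι, ∃ r : V → ℕ, Function.Injective r ∧ ∀ n,
      energy s t (fun x => decide (r x < n)) ≤ Γ ∧
      (energy s t (fun x => decide (r x < n)) < Γ ∨ (r (s e) < n ∧ r (t e) < n))) :
    (∀ a b : Fin q, a ≠ b → commHeight G (ground V a) (ground V b) = Γ) ∧
      ∀ σ : Config V q, σ ∉ groundStates V q →
        (commHeightSet G σ (groundStates V q) : ℤ) - (hamiltonian G σ : ℤ) < Γ := by
  refine ⟨fun a b hab => le_antisymm ?_ ?_, fun σ hσ => ?_⟩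
  · obtain ⟨r, hr, hle⟩ := hsweep (Classical.arbitrary ι)
    refine (reachableBelow_sweep hr b fun n => ?_).commHeight_le
    rw [hH]
    refine (energy_overwrite_le s t (ground V a) b fun x => decide (r x < n)).trans ?_
    have h0 : energy s t (ground V a) = 0 := energy_const s t a
    have := (hle n).1
    omega
  · refine le_commHeight_ground hk (fun σ c hc => ?_) hab
    rw [hH]
    exact (hcut (fun x => decide (σ x = c)) (by simpa using hc)).trans
      (energy_comp_le s t σ fun z => decide (z = c))
  · obtain ⟨e, he⟩ : ∃ e, σ (s e) ≠ σ (t e) := by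
      by_contra! hcon
      exact hσ ⟨σ (Classical.arbitrary V), funext fun x => hconst σ hcon _ _⟩
    obtain ⟨r, hr, hle⟩ := hsweep e
    -- At `n = 0` nothing is swept, so the strict alternative holds. Positivity makes the truncated
    -- `Γ - 1` below harmless.
    have hpos : 0 < Γ := by
      rcases (hle 0).2 with h | h <;> omega
    -- The saving on `e` does not depend on the spin; this one is at hand without knowing that `Fin
    -- q` is nonempty.
    let b := σ (s e)
    have hreach : ReachableBelow G (hamiltonian G σ + Γ - 1) σ (ground V b) := by
      refine reachableBelow_sweep hr b fun n => ?_
      rw [hH, hH]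
      rcases (hle n).2 with h | ⟨h1, h2⟩
      · have := energy_overwrite_le s t σ b fun x => decide (r x < n)
        omega
      · have := energy_overwrite_lt s t σ b (fun x => decide (r x < n)) e (by simpa using h1)
          (by simpa using h2) he
        have := (hle n).1
        omega
    have h1 : commHeightSet G σ (groundStates V q) ≤ commHeight G σ (ground V b) :=
      Nat.sInf_le ⟨_, ⟨b, rfl⟩, rfl⟩
    have h2 := hreach.commHeight_le
    omega

end Barrier

/-! ### Cyclic binary words -/

section Cyclic

variable {L : ℕ} [NeZero L]

/-- The number of unequal neighbours in the cyclic word `u 0, v 0, u 1, v 1, …` of length `2 L`. -/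
def cyclicCut (u v : ZMod L → Bool) : ℕ :=
  (∑ i, if v i = u i then 0 else 1) + ∑ i, if v i = u (i + 1) then 0 else 1

theorem cast_ite_bool_eq (a b : Bool) :
    (((if a = b then 0 else 1 : ℕ)) : ZMod 2) = (a.toNat : ZMod 2) + (b.toNat : ZMod 2) := by
  revert a b; decide

/-- Modulo 2 a disagreement is the sum of its two letters, and each letter has two neighbours. -/
theorem even_cyclicCut (u v : ZMod L → Bool) : Even (cyclicCut u v) := by
  rw [← ZMod.natCast_eq_zero_iff_even, cyclicCut]
  simp only [Nat.cast_add, Nat.cast_sum, cast_ite_bool_eq, Finset.sum_add_distrib]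
  have hs : ∑ i, ((u (i + 1)).toNat : ZMod 2) = ∑ i, ((u i).toNat : ZMod 2) :=
    Equiv.sum_comp (Equiv.addRight (1 : ZMod L)) fun i => ((u i).toNat : ZMod 2)
  rw [hs]
  exact CharTwo.add_self_eq_zero _

theorem two_le_cyclicCut {u v : ZMod L → Bool} (h : ¬∃ b, ∀ i, u i = b ∧ v i = b) :
    2 ≤ cyclicCut u v := by
  by_contra hlt
  obtain ⟨m, hm⟩ := even_cyclicCut u v
  have h0 : cyclicCut u v = 0 := by omega
  simp only [cyclicCut, Nat.add_eq_zero_iff, Finset.sum_eq_zero_iff, Finset.mem_univ,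
    forall_const, ite_eq_left_iff, one_ne_zero, imp_false, not_not] at h0
  obtain ⟨h1, h2⟩ := h0
  have hu : ∀ n : ℕ, u n = u 0 := by
    intro n
    induction n with
    | zero => simp
    | succ n ih => rw [Nat.cast_succ, ← h2, h1, ih]
  refine h ⟨u 0, fun i => ?_⟩
  have := hu i.val
  rw [ZMod.natCast_zmod_val] at this
  exact ⟨this, by rw [h1, this]⟩

theorem sum_ite_val_eq_le_one (m : ℕ) : (∑ i : ZMod L, if i.val = m then 1 else 0) ≤ 1 := by
  rw [← Finset.card_filter, Finset.card_le_one]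
  intro a ha b hb
  simp only [Finset.mem_filter, Finset.mem_univ, true_and] at ha hb
  exact ZMod.val_injective L (ha.trans hb.symm)

theorem val_add_one_cases (hL : 2 ≤ L) (i : ZMod L) :
    (i.val + 1 < L ∧ (i + 1).val = i.val + 1) ∨ (i.val = L - 1 ∧ (i + 1).val = 0) := by
  have h1 : (1 : ZMod L).val = 1 := ZMod.val_one'' (by omega)
  have hi := ZMod.val_lt i
  rw [ZMod.val_add, h1]
  by_cases h : i.val + 1 < L
  · exact Or.inl ⟨h, Nat.mod_eq_of_lt h⟩
  · have : i.val + 1 = L := by omega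
    exact Or.inr ⟨by omega, by rw [this, Nat.mod_self]⟩

/-- An initial segment of a cyclic word has at most two boundary edges. -/
theorem cyclicCut_initial_le_two (hL : 2 ≤ L) {a b : ℕ} (hab : a ≤ b) (hba : b ≤ a + 1) :
    cyclicCut (L := L) (fun i => decide (i.val < b)) (fun i => decide (i.val < a)) ≤ 2 := by
  -- The first sum can break only at `a`, and only if `b = a + 1`; the second only at the wrap, and
  -- at `a - 1` if `b = a`.
  have h1 : (∑ i : ZMod L, if decide (i.val < a) = decide (i.val < b) then 0 else 1) ≤ b - a := by
    rcases Nat.eq_or_lt_of_le hab with rfl | hlt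
    · simp
    · obtain rfl : b = a + 1 := by omega
      refine le_trans (Finset.sum_le_sum fun i _ => ?_)
        ((sum_ite_val_eq_le_one (L := L) a).trans (by omega))
      split_ifs with h h' <;> simp only [decide_eq_decide] at h <;> omega
  have h2 : (∑ i : ZMod L, if decide (i.val < a) = decide ((i + 1).val < b) then 0 else 1)
      ≤ 2 - (b - a) := by
    rcases Nat.eq_or_lt_of_le hab with rfl | hlt
    · have hs := add_le_add (sum_ite_val_eq_le_one (L := L) (L - 1))
        (sum_ite_val_eq_le_one (L := L) (a - 1))
      rw [← Finset.sum_add_distrib] at hs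
      refine le_trans (Finset.sum_le_sum fun i _ => ?_) (hs.trans (by omega))
      rcases val_add_one_cases hL i with ⟨h3, h4⟩ | ⟨h3, h4⟩ <;> rw [h4] <;>
        split_ifs with h <;> simp only [decide_eq_decide] at h <;> omega
    · obtain rfl : b = a + 1 := by omega
      refine le_trans (Finset.sum_le_sum fun i _ => ?_)
        ((sum_ite_val_eq_le_one (L := L) (L - 1)).trans (by omega))
      rcases val_add_one_cases hL i with ⟨h3, h4⟩ | ⟨h3, h4⟩ <;> rw [h4] <;>
        split_ifs with h <;> simp only [decide_eq_decide] at h <;> omega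
  have := add_le_add h1 h2
  exact this.trans (by omega)

theorem cyclicCut_eq_zero {u v : ZMod L → Bool} (b : Bool) (hu : ∀ i, u i = b)
    (hv : ∀ i, v i = b) : cyclicCut u v = 0 := by
  simp [cyclicCut, hu, hv]

end Cyclic

/-! ### Mixed fibres and confinement of a colour -/

section Mixed

variable {V K : Type} [Fintype V] [Fintype K] [DecidableEq K]

open Classical in
/-- The fibres of `ρ` on which `f` is not constant. -/
noncomputable def mixedFibers (ρ : V → K) (f : V → Bool) : Finset K :=
  Finset.univ.filter fun i => ∃ x y, ρ x = i ∧ ρ y = i ∧ f x ≠ f y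

theorem eq_of_notMem_mixedFibers {ρ : V → K} {f : V → Bool} {x y : V}
    (h : ρ x ∉ mixedFibers ρ f) (hxy : ρ y = ρ x) : f y = f x := by
  by_contra hne
  exact h (by simpa [mixedFibers] using ⟨y, hxy, x, rfl, hne⟩)

theorem two_mul_card_mixedFibers_le {ρ : V → K} {f : V → Bool} {c : K → ℕ}
    (hc : ∀ i ∈ mixedFibers ρ f, 2 ≤ c i) : 2 * (mixedFibers ρ f).card ≤ ∑ i, c i := by
  rw [mul_comm, ← smul_eq_mul]
  exact (Finset.card_nsmul_le_sum _ _ _ hc).trans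
    (Finset.sum_le_sum_of_subset (Finset.subset_univ _))

/-- With every fibre constant, the coloured set is a union of fibres. -/
theorem dvd_card_of_mixedFibers_eq_empty {ρ : V → K} {f : V → Bool} {n : ℕ}
    (hn : ∀ i, (Finset.univ.filter fun x => ρ x = i).card = n) (h : mixedFibers ρ f = ∅) :
    n ∣ (Finset.univ.filter fun x => f x = true).card := by
  rw [Finset.card_eq_sum_card_fiberwise (f := ρ) (t := Finset.univ) (by simp)]
  refine Finset.dvd_sum fun i _ => ?_
  by_cases hx : ∃ x, f x = true ∧ ρ x = i
  · obtain ⟨x, hx, rfl⟩ := hx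
    rw [← hn (ρ x)]
    refine dvd_of_eq (congrArg _ ?_)
    ext y
    simp only [Finset.mem_filter, Finset.mem_univ, true_and]
    refine ⟨fun hy => ⟨?_, hy⟩, fun hy => hy.2⟩
    exact (eq_of_notMem_mixedFibers (ρ := ρ) (f := f) (x := x) (by simp [h]) hy).trans hx
  · rw [Finset.card_eq_zero.2]
    · exact dvd_zero n
    · ext y
      simp only [Finset.mem_filter, Finset.mem_univ, true_and, Finset.notMem_empty, iff_false]
      exact fun hy => hx ⟨y, hy⟩

/-- If the fibres of `ρ` and `γ` cross each other in `m > 0` sites and both families have a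
constant fibre, then one of the two colours is confined to the crossings of mixed fibres. -/
theorem card_le_of_card_mixedFibers_lt {ρ γ : V → K} {f : V → Bool} {m : ℕ} (hm : 0 < m)
    (hcross : ∀ i j, (Finset.univ.filter fun x => ρ x = i ∧ γ x = j).card = m)
    (hρ : (mixedFibers ρ f).card < Fintype.card K) (hγ : (mixedFibers γ f).card < Fintype.card K) :
    ∃ b, (Finset.univ.filter fun x => f x = b).card
      ≤ m * ((mixedFibers ρ f).card * (mixedFibers γ f).card) := by
  obtain ⟨i, hi⟩ : ∃ i, i ∉ mixedFibers ρ f := by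
    by_contra! h
    exact hρ.ne ((Finset.card_eq_iff_eq_univ _).2 (Finset.eq_univ_iff_forall.2 h))
  obtain ⟨j, hj⟩ : ∃ j, j ∉ mixedFibers γ f := by
    by_contra! h
    exact hγ.ne ((Finset.card_eq_iff_eq_univ _).2 (Finset.eq_univ_iff_forall.2 h))
  have hex : ∀ i j, ∃ x, ρ x = i ∧ γ x = j := by
    intro i j
    have h := hcross i j
    obtain ⟨x, hx⟩ := Finset.card_pos.1 (h ▸ hm)
    exact ⟨x, by simpa using hx⟩
  obtain ⟨x₀, hx₀, hx₀'⟩ := hex i j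
  refine ⟨!f x₀, ?_⟩
  rw [← Finset.card_product]
  refine Finset.card_le_mul_card_image_of_maps_to (f := fun x => (ρ x, γ x)) ?_ m ?_
  · intro x hx
    have hfx : f x ≠ f x₀ := by
      have : f x = !f x₀ := by simpa using hx
      simp [this]
    refine Finset.mem_product.2
      ⟨by_contra fun hc => hfx ?_, by_contra fun hc => hfx ?_⟩
    -- If the `ρ`-fibre of `x` is constant, follow it to the constant fibre `j` of `γ`, then follow
    -- that to `x₀`: the colour never changes.
    · obtain ⟨y, hy, hy'⟩ := hex (ρ x) j
      rw [← eq_of_notMem_mixedFibers hc hy]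
      exact eq_of_notMem_mixedFibers (by rwa [hx₀']) (hy'.trans hx₀'.symm)
    · obtain ⟨y, hy, hy'⟩ := hex i (γ x)
      rw [← eq_of_notMem_mixedFibers hc hy']
      exact eq_of_notMem_mixedFibers (by rwa [hx₀]) (hy.trans hx₀.symm)
  · rintro ⟨i', j'⟩ -
    rw [← hcross i' j', Finset.filter_filter]
    refine Finset.card_le_card fun x hx => ?_
    simp only [Finset.mem_filter, Finset.mem_univ, true_and, Prod.mk.injEq] at hx ⊢
    exact hx.2

theorem card_fiber_of_crossing {ρ γ : V → K} {m : ℕ}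
    (hcross : ∀ i j, (Finset.univ.filter fun x => ρ x = i ∧ γ x = j).card = m) (i : K) :
    (Finset.univ.filter fun x => ρ x = i).card = Fintype.card K * m := by
  rw [Finset.card_eq_sum_card_fiberwise (f := γ) (t := Finset.univ) (by simp)]
  simp [Finset.filter_filter, hcross]

theorem card_true_add_card_false (f : V → Bool) :
    (Finset.univ.filter fun x => f x = true).card + (Finset.univ.filter fun x => f x = false).card
      = Fintype.card V := by
  have h := Finset.card_filter_add_card_filter_not (s := Finset.univ) (fun x => f x = true)
  simpa using h

end Mixed

/-! ### Arithmetic of the torus -/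

section Torus

variable {L : ℕ}

/-- Twice this number exceeds `L * L` by 1 or 2, neither of which `L` divides. -/
theorem not_dvd_half_sq_add_one (hL : 3 ≤ L) : ¬ L ∣ L * L / 2 + 1 := by
  intro h
  have h2 : L ∣ L * L + (2 - L * L % 2) := by
    have : L * L + (2 - L * L % 2) = 2 * (L * L / 2 + 1) := by omega
    rw [this]
    exact Dvd.dvd.mul_left h 2
  rw [Nat.dvd_add_right (Dvd.intro _ rfl)] at h2
  exact absurd (Nat.le_of_dvd (by omega) h2) (by omega)

theorem one_ne_zero_of_two_le (hL : 2 ≤ L) : (1 : ZMod L) ≠ 0 := by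
  have : Fact (1 < L) := ⟨hL⟩
  exact one_ne_zero

theorem two_ne_zero_of_three_le (hL : 3 ≤ L) : (1 + 1 : ZMod L) ≠ 0 := by
  intro h
  have h2 : ((2 : ℕ) : ZMod L) = 0 := by push_cast; rw [← h]; norm_num
  rw [ZMod.natCast_eq_zero_iff] at h2
  exact absurd (Nat.le_of_dvd (by norm_num) h2) (by omega)

variable [NeZero L]

theorem eq_of_forall_add_one_eq {α : Type*} {f : ZMod L → α} (h : ∀ i, f i = f (i + 1))
    (i j : ZMod L) : f i = f j := by
  have h0 : ∀ n : ℕ, f n = f 0 := by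
    intro n
    induction n with
    | zero => simp
    | succ n ih => rw [Nat.cast_succ, ← h, ih]
  have hi := h0 i.val
  have hj := h0 j.val
  rw [ZMod.natCast_zmod_val] at hi hj
  rw [hi, hj]

theorem lexicographic_injective : Function.Injective fun x : ZMod L × ZMod L =>
    x.1.val * L + x.2.val := by
  rintro ⟨i, j⟩ ⟨i', j'⟩ h
  dsimp only at h
  have hj := ZMod.val_lt j
  have hj' := ZMod.val_lt j'
  have h2 : j.val = j'.val := by
    have := congrArg (· % L) h
    simpa [Nat.mul_add_mod', Nat.mod_eq_of_lt hj, Nat.mod_eq_of_lt hj'] using this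
  have h1 : i.val = i'.val := by
    rw [h2] at h
    exact Nat.eq_of_mul_eq_mul_right (NeZero.pos L) (by omega)
  exact Prod.ext (ZMod.val_injective L h1) (ZMod.val_injective L h2)

end Torus

/-! ### The square lattice -/

section Square

variable {L : ℕ}

/-- The second end of the edge of the square lattice that starts at `e.1`, horizontal if `e.2`. -/
def squareTarget (e : (ZMod L × ZMod L) × Bool) : ZMod L × ZMod L :=
  e.1 + if e.2 then (1, 0) else (0, 1)

/-- For `L = 2` going round in two steps would give one edge two labels. -/
theorem squareTarget_injective (hL : 3 ≤ L) :
    Function.Injective fun e : (ZMod L × ZMod L) × Bool => s(e.1, squareTarget e) := by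
  have h1 := one_ne_zero_of_two_le (L := L) (by omega)
  have h2 := two_ne_zero_of_three_le hL
  rintro ⟨⟨i, j⟩, c⟩ ⟨⟨i', j'⟩, c'⟩ h
  rcases Sym2.eq_iff.1 h with ⟨h3, h4⟩ | ⟨h3, h4⟩
  · cases c <;> cases c' <;> simp_all [squareTarget]
  · exfalso
    cases c <;> cases c' <;> simp_all [squareTarget, add_assoc]

theorem squareLattice_adj_iff (hL : 2 ≤ L) (x y : ZMod L × ZMod L) :
    (squareLattice L).Adj x y ↔ ∃ e : (ZMod L × ZMod L) × Bool,
      s(e.1, squareTarget e) = s(x, y) := by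
  have h1 := one_ne_zero_of_two_le hL
  rw [squareLattice, SimpleGraph.fromRel_adj]
  constructor
  · rintro ⟨-, (rfl | rfl) | (rfl | rfl)⟩
    · exact ⟨(x, true), by simp [squareTarget]⟩
    · exact ⟨(x, false), by simp [squareTarget]⟩
    · exact ⟨(y, true), by simp [squareTarget, Sym2.eq_swap]⟩
    · exact ⟨(y, false), by simp [squareTarget, Sym2.eq_swap]⟩
  · rintro ⟨⟨z, c⟩, h⟩
    rcases Sym2.eq_iff.1 h with ⟨rfl, rfl⟩ | ⟨rfl, rfl⟩ <;> cases c <;>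
      simp [squareTarget, h1]

variable [NeZero L]

/-- Doubling every letter (`u = v`) makes `cyclicCut` count the disagreements of a plain cyclic word
of length `L`. -/
theorem square_energy_eq (A : ZMod L × ZMod L → Bool) :
    energy Prod.fst squareTarget A =
      (∑ i, cyclicCut (fun j => A (i, j)) fun j => A (i, j)) +
        ∑ j, cyclicCut (fun i => A (i, j)) fun i => A (i, j) := by
  simp only [energy, cyclicCut, squareTarget, Fintype.sum_prod_type, Fintype.sum_bool,
    Finset.sum_add_distrib, if_true, Finset.sum_const_zero, zero_add]
  rw [add_comm]
  congr 1
  · simp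
  · rw [Finset.sum_comm]
    simp

theorem square_energy_ge (hL : 5 ≤ L) {A : ZMod L × ZMod L → Bool}
    (hA : (Finset.univ.filter fun x => A x = true).card = L * L / 2 + 1) :
    2 * L + 2 ≤ energy Prod.fst squareTarget A := by
  have hr : 2 * (mixedFibers Prod.fst A).card
      ≤ ∑ i, cyclicCut (fun j => A (i, j)) fun j => A (i, j) := by
    refine two_mul_card_mixedFibers_le fun i hi => two_le_cyclicCut ?_
    rintro ⟨b, hb⟩
    simp [mixedFibers, hb] at hi
  have hc : 2 * (mixedFibers Prod.snd A).card
      ≤ ∑ j, cyclicCut (fun i => A (i, j)) fun i => A (i, j) := by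
    refine two_mul_card_mixedFibers_le fun j hj => two_le_cyclicCut ?_
    rintro ⟨b, hb⟩
    simp [mixedFibers, hb] at hj
  rw [square_energy_eq]
  have hndvd := not_dvd_half_sq_add_one (L := L) (by omega)
  have hcross : ∀ i j : ZMod L,
      (Finset.univ.filter fun x : ZMod L × ZMod L => x.1 = i ∧ x.2 = j).card = 1 := by
    intro i j
    rw [Finset.card_eq_one]
    exact ⟨(i, j), by ext ⟨a, b⟩; simp⟩
  have hcross' : ∀ i j : ZMod L,
      (Finset.univ.filter fun x : ZMod L × ZMod L => x.2 = i ∧ x.1 = j).card = 1 :=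
    fun i j => by simpa only [and_comm] using hcross j i
  have hr0 : mixedFibers Prod.fst A ≠ ∅ := fun h => hndvd <| by
    simpa [hA] using dvd_card_of_mixedFibers_eq_empty (card_fiber_of_crossing hcross) h
  have hc0 : mixedFibers Prod.snd A ≠ ∅ := fun h => hndvd <| by
    simpa [hA] using dvd_card_of_mixedFibers_eq_empty (card_fiber_of_crossing hcross') h
  rw [← Finset.nonempty_iff_ne_empty, ← Finset.card_pos] at hr0 hc0
  by_contra hlt
  obtain ⟨b, hb⟩ := card_le_of_card_mixedFibers_lt (f := A) one_pos hcross
    (by rw [ZMod.card]; omega) (by rw [ZMod.card]; omega)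
  have htot := card_true_add_card_false A
  rw [Fintype.card_prod, ZMod.card] at htot
  generalize (mixedFibers Prod.fst A).card = r at *
  generalize (mixedFibers Prod.snd A).card = c at *
  have hrc : r + c ≤ L := by omega
  -- By AM-GM the confined colour has at most L²/4 sites, but both colours have at least L²/2 - 1.
  have h4 : 4 * (r * c) ≤ L * L := by nlinarith [sq_nonneg ((r : ℤ) - c), four_mul_le_sq_add r c]
  have h25 : 5 * 5 ≤ L * L := Nat.mul_le_mul hL hL
  cases b <;> omega

theorem square_energy_translate (x₀ : ZMod L × ZMod L) (B : ZMod L × ZMod L → Bool) :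
    energy Prod.fst squareTarget (fun x => B (x - x₀)) = energy Prod.fst squareTarget B := by
  unfold energy
  refine Fintype.sum_equiv ((Equiv.subRight x₀).prodCongr (Equiv.refl Bool)) _ _ fun e => ?_
  simp [squareTarget, add_sub_right_comm]

/-- All L lines across the sweep see initial segments, costing at most 2 each; along the sweep only
the partly filled line costs, at most 2. For `n = L` no line is partly filled, and for `n < L` the
last transversal line is untouched. -/
theorem lexicographic_cut_le (hL : 2 ≤ L) (n : ℕ) :
    energy Prod.fst squareTarget (fun x : ZMod L × ZMod L => decide (x.1.val * L + x.2.val < n))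
      ≤ 2 * L + 2 ∧
    (n ≤ L → energy Prod.fst squareTarget
      (fun x : ZMod L × ZMod L => decide (x.1.val * L + x.2.val < n)) < 2 * L + 2) := by
  rw [square_energy_eq]
  set R : ZMod L → ℕ := fun i => cyclicCut (fun j : ZMod L => decide (i.val * L + j.val < n))
    fun j => decide (i.val * L + j.val < n) with hR
  set C : ZMod L → ℕ := fun j => cyclicCut (fun i : ZMod L => decide (i.val * L + j.val < n))
    fun i => decide (i.val * L + j.val < n) with hC
  change (∑ i, R i) + (∑ j, C j) ≤ _ ∧ (_ → (∑ i, R i) + (∑ j, C j) < _)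
  have hR2 : ∀ i, R i ≤ 2 := by
    intro i
    have h : ∀ j : ZMod L, i.val * L + j.val < n ↔ j.val < n - i.val * L := fun j => by omega
    simp only [hR, h]
    exact cyclicCut_initial_le_two hL le_rfl (Nat.le_succ _)
  have hC2 : ∀ j, C j ≤ 2 := by
    intro j
    -- The bound is (n - j)/L rounded up; truncation gives 0 when n < j.
    have h : ∀ i : ZMod L, i.val * L + j.val < n ↔ i.val < (n - j.val + (L - 1)) / L := by
      intro i
      rw [Nat.lt_iff_add_one_le (m := i.val), Nat.le_div_iff_mul_le (by omega), add_mul]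
      omega
    simp only [hC, h]
    exact cyclicCut_initial_le_two hL le_rfl (Nat.le_succ _)
  have hR0 : ∀ i, R i ≠ 0 → i.val = n / L ∧ n % L ≠ 0 := by
    intro i hi
    have h1 : i.val * L < n := by
      by_contra hc
      exact hi (cyclicCut_eq_zero false (fun j => by simp; omega) fun j => by simp; omega)
    have h2 : n < i.val * L + L := by
      by_contra hc
      refine hi (cyclicCut_eq_zero true (fun j => ?_) fun j => ?_) <;>
        · have := ZMod.val_lt j
          simp; omega
    have h3 : n / L = i.val := Nat.div_eq_of_lt_le h1.le (by rw [Nat.succ_mul]; exact h2)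
    refine ⟨h3.symm, fun h4 => ?_⟩
    have := Nat.div_add_mod n L
    rw [h3, h4, mul_comm] at this
    omega
  have hRsum : ∑ i, R i ≤ 2 := by
    have := sum_ite_val_eq_le_one (L := L) (n / L)
    calc ∑ i, R i ≤ ∑ i : ZMod L, 2 * (if i.val = n / L then 1 else 0) := by
          refine Finset.sum_le_sum fun i _ => ?_
          by_cases hi : R i = 0
          · omega
          · simpa [(hR0 i hi).1] using hR2 i
      _ ≤ 2 := by rw [← Finset.mul_sum]; omega
  have hCsum : ∑ j, C j ≤ 2 * L := by
    have := Finset.sum_le_card_nsmul Finset.univ C 2 fun j _ => hC2 j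
    rwa [Finset.card_univ, ZMod.card, smul_eq_mul, mul_comm] at this
  refine ⟨by omega, fun hn => ?_⟩
  rcases hn.eq_or_lt with rfl | hlt
  · have : ∑ i, R i = 0 := Finset.sum_eq_zero fun i _ => by
      by_contra hi
      exact (hR0 i hi).2 (Nat.mod_self n)
    omega
  · have hlast : C ((L - 1 : ℕ) : ZMod L) = 0 := by
      have hv : ((L - 1 : ℕ) : ZMod L).val = L - 1 := ZMod.val_natCast_of_lt (by omega)
      refine cyclicCut_eq_zero false (fun i => ?_) fun i => ?_ <;>
        · simp [hv]; omega
    have : ∑ j, C j < ∑ _j : ZMod L, 2 :=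
      Finset.sum_lt_sum (fun j _ => hC2 j) ⟨_, Finset.mem_univ _, by rw [hlast]; norm_num⟩
    rw [Finset.sum_const, Finset.card_univ, ZMod.card, smul_eq_mul] at this
    omega

theorem square_barrier (hL : 5 ≤ L) (q : ℕ) :
    (∀ a b : Fin q, a ≠ b → commHeight (squareLattice L) (ground _ a) (ground _ b) = 2 * L + 2) ∧
      ∀ σ : Config (ZMod L × ZMod L) q, σ ∉ groundStates _ q →
        (commHeightSet (squareLattice L) σ (groundStates _ q) : ℤ)
          - (hamiltonian (squareLattice L) σ : ℤ) < (2 * L + 2 : ℕ) := by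
  have h1 : (1 : ZMod L).val = 1 := ZMod.val_one'' (by omega)
  refine barrier_of_sweep_of_cut (s := Prod.fst) (t := squareTarget) (k := L * L / 2 + 1)
    (hamiltonian_eq_energy (squareTarget_injective (by omega))
      (squareLattice_adj_iff (by omega))) ?_ ?_ (fun A hA => square_energy_ge hL hA) ?_
  · intro σ hσ x y
    have hv : ∀ i j j', σ (i, j) = σ (i, j') := fun i => eq_of_forall_add_one_eq fun j => by
      simpa [squareTarget] using hσ ((i, j), false)
    have hh : ∀ j i i', σ (i, j) = σ (i', j) := fun j =>
      eq_of_forall_add_one_eq (f := fun i => σ (i, j)) fun i => by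
        simpa [squareTarget] using hσ ((i, j), true)
    exact (hv x.1 x.2 y.2).trans (hh y.2 x.1 y.1)
  · have : 5 * 5 ≤ L * L := Nat.mul_le_mul hL hL
    rw [Fintype.card_prod, ZMod.card]
    omega
  · intro e
    refine ⟨fun x => (x - e.1).1.val * L + (x - e.1).2.val,
      lexicographic_injective.comp (sub_left_injective (b := e.1)), fun n => ?_⟩
    have ht := square_energy_translate e.1 fun x => decide (x.1.val * L + x.2.val < n)
    rw [ht]
    obtain ⟨h2, h3⟩ := lexicographic_cut_le (L := L) (by omega) n
    refine ⟨h2, ?_⟩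
    -- The ends of `e` have ranks 0 and 1 or `L`, so both are swept when `n > L`.
    rcases le_or_gt n L with hn | hn
    · exact Or.inl (h3 hn)
    · refine Or.inr ⟨?_, ?_⟩
      · simp; omega
      · cases he : e.2 <;> simp [squareTarget, he, h1] <;> omega

end Square

/-! ### The hexagonal lattice -/

section Hexagonal

variable {L : ℕ}

/-- The three translations that take a cell `p` to the cells of the neighbours of `(p, true)`. -/
def hexShift : Fin 3 → ZMod L × ZMod L := ![0, (1, 0), (0, 1)]

/-- The end of the edge `e` of the hexagonal lattice that is not `(e.1, true)`. -/
def hexTarget (e : (ZMod L × ZMod L) × Fin 3) : HexSite L := (e.1 + hexShift e.2, false)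

theorem hexShift_injective (hL : 2 ≤ L) : Function.Injective (hexShift (L := L)) := by
  have h1 := one_ne_zero_of_two_le hL
  intro a b h
  fin_cases a <;> fin_cases b <;> simp_all [hexShift, Prod.ext_iff]

theorem hexTarget_injective (hL : 2 ≤ L) :
    Function.Injective fun e : (ZMod L × ZMod L) × Fin 3 =>
      s(((e.1, true) : HexSite L), hexTarget e) := by
  rintro ⟨p, c⟩ ⟨p', c'⟩ h
  rcases Sym2.eq_iff.1 h with ⟨h3, h4⟩ | ⟨h3, h4⟩
  · simp only [Prod.mk.injEq, and_true] at h3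
    subst h3
    simp only [hexTarget, Prod.mk.injEq, add_right_inj, and_true] at h4
    rw [hexShift_injective hL h4]
  · simp [hexTarget] at h3

theorem hexLattice_adj_iff (x y : HexSite L) :
    (hexLattice L).Adj x y ↔ ∃ e : (ZMod L × ZMod L) × Fin 3,
      s(((e.1, true) : HexSite L), hexTarget e) = s(x, y) := by
  have key : ∀ x y : HexSite L, (x.2 = true ∧ y.2 = false ∧
      (y.1 = x.1 ∨ y.1 = x.1 + (1, 0) ∨ y.1 = x.1 + (0, 1))) ↔
      ∃ e : (ZMod L × ZMod L) × Fin 3, ((e.1, true) : HexSite L) = x ∧ hexTarget e = y := by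
    rintro ⟨p, a⟩ ⟨p', a'⟩
    constructor
    · rintro ⟨h1, h2, h⟩
      dsimp only at h1 h2 h
      subst h1 h2
      rcases h with rfl | rfl | rfl
      · exact ⟨(p', 0), rfl, by simp [hexTarget, hexShift]⟩
      · exact ⟨(p, 1), rfl, by simp [hexTarget, hexShift]⟩
      · exact ⟨(p, 2), rfl, by simp [hexTarget, hexShift]⟩
    · rintro ⟨⟨r, d⟩, h1, h2⟩
      simp only [hexTarget, Prod.mk.injEq] at h1 h2
      obtain ⟨⟨rfl, rfl⟩, rfl, rfl⟩ := And.intro h1 h2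
      fin_cases d <;> simp [hexShift]
  rw [hexLattice, SimpleGraph.fromRel_adj, key, key, ← exists_or]
  simp only [Sym2.eq_iff]
  constructor
  · rintro ⟨-, e, h | h⟩
    · exact ⟨e, Or.inl h⟩
    · exact ⟨e, Or.inr h⟩
  · rintro ⟨e, h⟩
    refine ⟨?_, e, h⟩
    rintro rfl
    rcases h with ⟨h1, h2⟩ | ⟨h1, h2⟩ <;> rw [← h1] at h2 <;> simp [hexTarget] at h2

/-- As z is at least the mean of x and y, x + y ≤ 4L/3, and AM-GM bounds the product. -/
theorem mul_le_of_sum_le_of_le_max {x y z : ℕ} (hx : 0 < x) (hy : 0 < y) (hxz : x ≤ z)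
    (hyz : y ≤ z) (h : x + y + z ≤ 2 * L) : x < L ∧ y < L ∧ 9 * (x * y) ≤ 4 * (L * L) := by
  refine ⟨by omega, by omega, ?_⟩
  have h1 : 3 * (x + y) ≤ 4 * L := by omega
  have h2 := Nat.mul_le_mul h1 h1
  have h3 := four_mul_le_sq_add x y
  nlinarith

variable [NeZero L]

/-- The number of edges in the direction `d` across which `A` is not constant. -/
def hexCut (A : HexSite L → Bool) (d : Fin 3) : ℕ :=
  ∑ p, if A (p, true) = A (p + hexShift d, false) then 0 else 1

theorem hex_energy_eq (A : HexSite L → Bool) :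
    energy (fun e => (e.1, true)) hexTarget A = hexCut A 0 + hexCut A 1 + hexCut A 2 := by
  unfold energy hexCut
  rw [Fintype.sum_prod_type_right, Fin.sum_univ_three]
  rfl

/-- A strip of triangles is a closed zigzag alternating between the two types, using two of the
three edge directions. Each direction occurs in two of the three families, so the three strip sums
add up to twice the cut. -/
theorem hex_sum_rows (A : HexSite L → Bool) :
    ∑ i, cyclicCut (fun j => A ((i, j), false)) (fun j => A ((i, j), true))
      = hexCut A 0 + hexCut A 2 := by
  simp [cyclicCut, hexCut, hexShift, Finset.sum_add_distrib, Fintype.sum_prod_type]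

theorem hex_sum_columns (A : HexSite L → Bool) :
    ∑ j, cyclicCut (fun i => A ((i, j), false)) (fun i => A ((i, j), true))
      = hexCut A 0 + hexCut A 1 := by
  simp [cyclicCut, hexCut, hexShift, Finset.sum_add_distrib, Fintype.sum_prod_type_right]

theorem hex_sum_diagonals (A : HexSite L → Bool) :
    ∑ s, cyclicCut (fun j => A ((s + 1 - j, j), false)) (fun j => A ((s - j, j), true))
      = hexCut A 1 + hexCut A 2 := by
  simp only [cyclicCut, hexCut, hexShift, Finset.sum_add_distrib, Fintype.sum_prod_type_right]
  congr 1 <;> rw [Finset.sum_comm] <;> refine Finset.sum_congr rfl fun j _ => ?_ <;>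
    refine Fintype.sum_equiv (Equiv.subRight j) _ _ fun s => ?_
  · simp [sub_add_eq_add_sub]
  · simp

/-- The hexagonal lattice is cubic, so that a cut has the parity of its sides. -/
theorem hex_energy_cast (A : HexSite L → Bool) :
    (energy (fun e => (e.1, true)) hexTarget A : ZMod 2)
      = ((Finset.univ.filter fun x => A x = true).card : ZMod 2) := by
  have hd : ∀ d, (hexCut A d : ZMod 2)
      = ((Finset.univ.filter fun x => A x = true).card : ZMod 2) := by
    intro d
    have hs : ∑ p, ((A (p + hexShift d, false)).toNat : ZMod 2)
        = ∑ p, ((A (p, false)).toNat : ZMod 2) :=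
      Equiv.sum_comp (Equiv.addRight (hexShift d)) fun p => ((A (p, false)).toNat : ZMod 2)
    have ht : ∀ x, ((if A x = true then 1 else 0 : ℕ) : ZMod 2) = ((A x).toNat : ZMod 2) := by
      intro x
      cases A x <;> rfl
    rw [Finset.card_filter]
    simp only [hexCut, Nat.cast_sum, cast_ite_bool_eq, ht]
    rw [Finset.sum_add_distrib, hs,
      Fintype.sum_prod_type_right fun x : HexSite L => ((A x).toNat : ZMod 2), Fintype.sum_bool]
  rw [hex_energy_eq]
  push_cast
  rw [hd, hd, hd, CharTwo.add_self_eq_zero, zero_add]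

theorem hex_energy_ge (hL : 5 ≤ L) {A : HexSite L → Bool}
    (hA : (Finset.univ.filter fun x => A x = true).card = 2 * (L * L / 2 + 1)) :
    2 * L + 2 ≤ energy (fun e => (e.1, true)) hexTarget A := by
  have h25 : 5 * 5 ≤ L * L := Nat.mul_le_mul hL hL
  have heven : Even (energy (fun e => (e.1, true)) hexTarget A) := by
    rw [← ZMod.natCast_eq_zero_iff_even, hex_energy_cast, hA, ZMod.natCast_eq_zero_iff_even]
    exact even_two_mul _
  let ρ : HexSite L → ZMod L := fun x => x.1.1
  let γ : HexSite L → ZMod L := fun x => x.1.2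
  -- The index of the diagonal strip: its cells have coordinate sum `s` for type `true` and `s + 1`
  -- for type `false`.
  let δ : HexSite L → ZMod L := fun x => x.1.1 + x.1.2 - if x.2 then 0 else 1
  have hr : 2 * (mixedFibers ρ A).card ≤ hexCut A 0 + hexCut A 2 := by
    rw [← hex_sum_rows]
    refine two_mul_card_mixedFibers_le fun i hi => two_le_cyclicCut ?_
    rintro ⟨b, hb⟩
    simp [mixedFibers, ρ, forall_and] at hi hb
    simp [hb] at hi
  have hc : 2 * (mixedFibers γ A).card ≤ hexCut A 0 + hexCut A 1 := by
    rw [← hex_sum_columns]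
    refine two_mul_card_mixedFibers_le fun i hi => two_le_cyclicCut ?_
    rintro ⟨b, hb⟩
    simp [mixedFibers, γ, forall_and] at hi hb
    simp [hb] at hi
  have hd : 2 * (mixedFibers δ A).card ≤ hexCut A 1 + hexCut A 2 := by
    rw [← hex_sum_diagonals]
    refine two_mul_card_mixedFibers_le fun s hs => two_le_cyclicCut ?_
    rintro ⟨b, hb⟩
    have hall : ∀ x, δ x = s → A x = b := by
      rintro ⟨⟨i, j⟩, c⟩ hx
      have := hb j
      cases c
      · rw [← this.1, ← hx]; simp [δ]
      · rw [← this.2, ← hx]; simp [δ]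
    simp only [mixedFibers, Finset.mem_filter, Finset.mem_univ, true_and] at hs
    obtain ⟨x, y, hx, hy, hne⟩ := hs
    exact hne ((hall x hx).trans (hall y hy).symm)
  have hργ : ∀ i j, (Finset.univ.filter fun x => ρ x = i ∧ γ x = j).card = 2 := by
    intro i j
    rw [Finset.card_eq_two]
    refine ⟨((i, j), true), ((i, j), false), by simp, ?_⟩
    ext ⟨⟨a, b⟩, c⟩
    cases c <;> simp [ρ, γ]
  have hρδ : ∀ i s, (Finset.univ.filter fun x => ρ x = i ∧ δ x = s).card = 2 := by
    intro i s
    rw [Finset.card_eq_two]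
    refine ⟨((i, s - i), true), ((i, s + 1 - i), false), by simp, ?_⟩
    ext ⟨⟨a, b⟩, c⟩
    cases c <;> simp [ρ, δ] <;> grind
  have hγδ : ∀ j s, (Finset.univ.filter fun x => γ x = j ∧ δ x = s).card = 2 := by
    intro j s
    rw [Finset.card_eq_two]
    refine ⟨((s - j, j), true), ((s + 1 - j, j), false), by simp, ?_⟩
    ext ⟨⟨a, b⟩, c⟩
    cases c <;> simp [γ, δ] <;> grind
  have hndvd : ¬ L * 2 ∣ 2 * (L * L / 2 + 1) := by
    rw [mul_comm L 2, Nat.mul_dvd_mul_iff_left (by norm_num)]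
    exact not_dvd_half_sq_add_one (by omega)
  have hpos : ∀ {α β : HexSite L → ZMod L},
      (∀ i j, (Finset.univ.filter fun x => α x = i ∧ β x = j).card = 2) →
      0 < (mixedFibers α A).card := by
    intro α β hcross
    rw [Finset.card_pos, Finset.nonempty_iff_ne_empty]
    intro h
    have := dvd_card_of_mixedFibers_eq_empty (card_fiber_of_crossing hcross) h
    rw [hA, ZMod.card] at this
    exact hndvd this
  have hsmall : ∀ {α β : HexSite L → ZMod L},
      (∀ i j, (Finset.univ.filter fun x => α x = i ∧ β x = j).card = 2) →
      (mixedFibers α A).card < L ∧ (mixedFibers β A).card < L ∧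
        9 * ((mixedFibers α A).card * (mixedFibers β A).card) ≤ 4 * (L * L) → False := by
    rintro α β hcross ⟨h1, h2, h3⟩
    obtain ⟨b, hb⟩ := card_le_of_card_mixedFibers_lt (f := A) two_pos hcross
      (by rwa [ZMod.card]) (by rwa [ZMod.card])
    have htot := card_true_add_card_false A
    rw [Fintype.card_prod, Fintype.card_prod, ZMod.card, Fintype.card_bool] at htot
    -- The confined colour has at most 8L²/9 sites, but both have at least L² - 2, which is larger
    -- for `L ≥ 5`.
    cases b <;> omega
  have hr0 := hpos hργ
  have hc0 := hpos hγδ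
  have hd0 : 0 < (mixedFibers δ A).card :=
    hpos (β := ρ) fun s i => by simpa only [and_comm] using hρδ i s
  rw [hex_energy_eq] at heven ⊢
  by_contra hlt
  obtain ⟨m, hm⟩ := heven
  -- An even cut below 2L + 2 is at most 2L; without parity the bound would be 2L + 1. The two
  -- families with fewest mixed strips then give the contradiction.
  have hsum : (mixedFibers ρ A).card + (mixedFibers γ A).card + (mixedFibers δ A).card
      ≤ 2 * L := by omega
  rcases le_total (mixedFibers ρ A).card (mixedFibers γ A).card with h1 | h1
  · rcases le_total (mixedFibers γ A).card (mixedFibers δ A).card with h2 | h2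
    · exact hsmall hργ (mul_le_of_sum_le_of_le_max hr0 hc0 (h1.trans h2) h2 hsum)
    · exact hsmall hρδ (mul_le_of_sum_le_of_le_max hr0 hd0 h1 h2 (by omega))
  · rcases le_total (mixedFibers ρ A).card (mixedFibers δ A).card with h2 | h2
    · exact hsmall hργ (mul_le_of_sum_le_of_le_max hr0 hc0 h2 (h1.trans h2) hsum)
    · exact hsmall hγδ (mul_le_of_sum_le_of_le_max hc0 hd0 h1 h2 (by omega))

/-- The position of a site in the sweep of the hexagonal lattice, strip after strip. -/
def hexRank (x : HexSite L) : ℕ := (x.1.1.val * L + x.1.2.val) * 2 + x.2.toNat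

theorem hexRank_injective : Function.Injective (hexRank (L := L)) := by
  rintro ⟨p, a⟩ ⟨p', a'⟩ h
  simp only [hexRank] at h
  have h1 := Bool.toNat_lt a
  have h2 := Bool.toNat_lt a'
  have h3 : a.toNat = a'.toNat := by omega
  have h4 : p.1.val * L + p.2.val = p'.1.val * L + p'.2.val := by omega
  exact Prod.ext (lexicographic_injective h4) (by cases a <;> cases a' <;> simp_all)

theorem hex_energy_translate (p₀ : ZMod L × ZMod L) (B : HexSite L → Bool) :
    energy (fun e => (e.1, true)) hexTarget (fun x => B (x.1 - p₀, x.2))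
      = energy (fun e => (e.1, true)) hexTarget B := by
  unfold energy
  refine Fintype.sum_equiv ((Equiv.subRight p₀).prodCongr (Equiv.refl (Fin 3))) _ _ fun e => ?_
  simp [hexTarget, add_sub_right_comm]

/-- Row and column strips together cover every edge, those of direction 0 twice; so the cut is at
most 2 for the partly filled row strip plus 2 for each column strip, minus `hexCut A 0`. -/
theorem hexRank_cut_le (hL : 2 ≤ L) (n : ℕ) :
    energy (fun e => (e.1, true)) hexTarget (fun x : HexSite L => decide (hexRank x < n))
      ≤ 2 * L + 2 ∧
    (n ≤ 2 * L → energy (fun e => (e.1, true)) hexTarget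
      (fun x : HexSite L => decide (hexRank x < n)) < 2 * L + 2) := by
  set A : HexSite L → Bool := fun x => decide (hexRank x < n) with hA
  set R : ZMod L → ℕ :=
    fun i => cyclicCut (fun j => A ((i, j), false)) fun j => A ((i, j), true) with hR
  set C : ZMod L → ℕ :=
    fun j => cyclicCut (fun i => A ((i, j), false)) fun i => A ((i, j), true) with hC
  have hRs : ∑ i, R i = hexCut A 0 + hexCut A 2 := hex_sum_rows A
  have hCs : ∑ j, C j = hexCut A 0 + hexCut A 1 := hex_sum_columns A
  rw [hex_energy_eq]
  have hf : ∀ i j, A ((i, j), false) = decide ((i.val * L + j.val) * 2 < n) := fun i j => rfl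
  have ht : ∀ i j, A ((i, j), true) = decide ((i.val * L + j.val) * 2 + 1 < n) := fun i j => rfl
  have hR2 : ∀ i, R i ≤ 2 := by
    intro i
    have h1 : ∀ j : ZMod L, (i.val * L + j.val) * 2 < n ↔ j.val < (n - i.val * L * 2 + 1) / 2 :=
      fun j => by omega
    have h2 : ∀ j : ZMod L, (i.val * L + j.val) * 2 + 1 < n ↔ j.val < (n - i.val * L * 2) / 2 :=
      fun j => by omega
    simp only [hR, hf, ht, h1, h2]
    exact cyclicCut_initial_le_two hL (by omega) (by omega)
  have hC2 : ∀ j, C j ≤ 2 := by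
    intro j
    have h0 : ∀ (i : ZMod L) (c : ℕ), (i.val * L + j.val) * 2 + c < n ↔
        i.val < (n - (j.val * 2 + c) + (2 * L - 1)) / (2 * L) := by
      intro i c
      have : (i.val + 1) * (2 * L) = i.val * L * 2 + 2 * L := by ring
      rw [Nat.lt_iff_add_one_le (m := i.val), Nat.le_div_iff_mul_le (by omega), this]
      omega
    have h1 := fun i => h0 i 0
    have h2 := fun i => h0 i 1
    simp only [add_zero] at h1
    simp only [hC, hf, ht, h1, h2]
    refine cyclicCut_initial_le_two hL (Nat.div_le_div_right (by omega)) ?_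
    rw [← Nat.add_div_right _ (by omega : 0 < 2 * L)]
    exact Nat.div_le_div_right (by omega)
  have hR0 : ∀ i, R i ≠ 0 → i.val = n / (2 * L) ∧ n % (2 * L) ≠ 0 := by
    intro i hi
    have h1 : i.val * L * 2 < n := by
      by_contra hc
      exact hi (cyclicCut_eq_zero false (fun j => by rw [hf]; simp; omega)
        fun j => by rw [ht]; simp; omega)
    have h2 : n < i.val * L * 2 + 2 * L := by
      by_contra hc
      refine hi (cyclicCut_eq_zero true (fun j => ?_) fun j => ?_) <;>
        · have := ZMod.val_lt j
          simp only [hf, ht, decide_eq_true_eq]; omega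
    have h5 : i.val * L * 2 = i.val * (2 * L) := by ring
    have h3 : n / (2 * L) = i.val :=
      Nat.div_eq_of_lt_le (by omega) (by rw [Nat.succ_mul]; omega)
    refine ⟨h3.symm, fun h4 => ?_⟩
    have := Nat.div_add_mod n (2 * L)
    rw [h3, h4, mul_comm] at this
    omega
  have hRsum : ∑ i, R i ≤ 2 := by
    have := sum_ite_val_eq_le_one (L := L) (n / (2 * L))
    calc ∑ i, R i ≤ ∑ i : ZMod L, 2 * (if i.val = n / (2 * L) then 1 else 0) := by
          refine Finset.sum_le_sum fun i _ => ?_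
          by_cases hi : R i = 0
          · omega
          · simpa [(hR0 i hi).1] using hR2 i
      _ ≤ 2 := by rw [← Finset.mul_sum]; omega
  have hCsum : ∑ j, C j ≤ 2 * L := by
    have := Finset.sum_le_card_nsmul Finset.univ C 2 fun j _ => hC2 j
    rwa [Finset.card_univ, ZMod.card, smul_eq_mul, mul_comm] at this
  refine ⟨by omega, fun hn => ?_⟩
  have hv : ((L - 1 : ℕ) : ZMod L).val = L - 1 := ZMod.val_natCast_of_lt (by omega)
  rcases hn.eq_or_lt with rfl | hlt
  · have : ∑ i, R i = 0 := Finset.sum_eq_zero fun i _ => by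
      by_contra hi
      exact (hR0 i hi).2 (Nat.mod_self _)
    omega
  -- Below `2 * L - 1` the last column strip is untouched. At `n = 2 * L - 1` it contains one swept
  -- triangle, and the edge to its partner in the same cell, counted twice, gives the strictness.
  rcases Nat.lt_or_ge n (2 * L - 1) with hlt' | hge
  · have hlast : C ((L - 1 : ℕ) : ZMod L) = 0 := by
      refine cyclicCut_eq_zero false (fun i => ?_) fun i => ?_ <;>
        · simp [hf, ht, hv]; omega
    have : ∑ j, C j < ∑ _j : ZMod L, 2 :=
      Finset.sum_lt_sum (fun j _ => hC2 j) ⟨_, Finset.mem_univ _, by rw [hlast]; norm_num⟩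
    rw [Finset.sum_const, Finset.card_univ, ZMod.card, smul_eq_mul] at this
    omega
  · have : 0 < hexCut A 0 := by
      refine Finset.sum_pos' (fun _ _ => Nat.zero_le _)
        ⟨(0, ((L - 1 : ℕ) : ZMod L)), Finset.mem_univ _, ?_⟩
      have h1 : A ((0, ((L - 1 : ℕ) : ZMod L)), true) = false := by
        rw [ht, hv, ZMod.val_zero]; simp; omega
      have h2 : A ((0, ((L - 1 : ℕ) : ZMod L)), false) = true := by
        rw [hf, hv, ZMod.val_zero]; simp; omega
      simp [hexShift, h1, h2]
    omega

theorem hex_barrier (hL : 5 ≤ L) (q : ℕ) :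
    (∀ a b : Fin q, a ≠ b → commHeight (hexLattice L) (ground _ a) (ground _ b) = 2 * L + 2) ∧
      ∀ σ : Config (HexSite L) q, σ ∉ groundStates _ q →
        (commHeightSet (hexLattice L) σ (groundStates _ q) : ℤ)
          - (hamiltonian (hexLattice L) σ : ℤ) < (2 * L + 2 : ℕ) := by
  have h1 : (1 : ZMod L).val = 1 := ZMod.val_one'' (by omega)
  refine barrier_of_sweep_of_cut (s := fun e => (e.1, true)) (t := hexTarget)
    (k := 2 * (L * L / 2 + 1))
    (hamiltonian_eq_energy (hexTarget_injective (by omega)) hexLattice_adj_iff) ?_ ?_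
    (fun A hA => hex_energy_ge hL hA) ?_
  · intro σ hσ x y
    have h0 : ∀ p, σ (p, true) = σ (p, false) := fun p => by
      simpa [hexTarget, hexShift] using hσ (p, 0)
    have hv : ∀ i j j', σ ((i, j), false) = σ ((i, j'), false) := fun i =>
      eq_of_forall_add_one_eq (f := fun j => σ ((i, j), false)) fun j => by
        simpa [hexTarget, hexShift, h0] using hσ ((i, j), 2)
    have hh : ∀ j i i', σ ((i, j), false) = σ ((i', j), false) := fun j =>
      eq_of_forall_add_one_eq (f := fun i => σ ((i, j), false)) fun i => by
        simpa [hexTarget, hexShift, h0] using hσ ((i, j), 1)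
    have hx : ∀ x : HexSite L, σ x = σ (x.1, false) := by
      rintro ⟨p, _ | _⟩
      · rfl
      · exact h0 p
    rw [hx x, hx y]
    exact (hv x.1.1 x.1.2 y.1.2).trans (hh y.1.2 x.1.1 y.1.1)
  · have : 5 * 5 ≤ L * L := Nat.mul_le_mul hL hL
    rw [Fintype.card_prod, Fintype.card_prod, ZMod.card, Fintype.card_bool]
    omega
  · intro e
    refine ⟨fun x => hexRank (x.1 - e.1, x.2), fun x y h => ?_, fun n => ?_⟩
    · have := hexRank_injective h
      simp only [Prod.mk.injEq, sub_left_inj] at this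
      exact Prod.ext this.1 this.2
    have ht := hex_energy_translate e.1 fun x => decide (hexRank x < n)
    rw [ht]
    obtain ⟨h2, h3⟩ := hexRank_cut_le (L := L) (by omega) n
    refine ⟨h2, ?_⟩
    -- The `true` end of `e` has rank 1, the other 0, 2 or `2 * L`.
    rcases le_or_gt n (2 * L) with hn | hn
    · exact Or.inl (h3 hn)
    · refine Or.inr ⟨?_, ?_⟩
      · simp [hexRank]; omega
      · obtain ⟨p, d⟩ := e
        fin_cases d <;> simp [hexTarget, hexShift, hexRank, h1] <;> omega

end Hexagonal

end PottsTorus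

theorem theorem3p1 (L q : ℕ) [NeZero L] (hL : 8 ≤ L) (hq : 2 ≤ q) :
    ((∀ a b : Fin q, a ≠ b →
        PottsTorus.commHeight (PottsTorus.squareLattice L)
          (PottsTorus.ground _ a) (PottsTorus.ground _ b) = 2 * L + 2) ∧
      ∀ σ : PottsTorus.Config (ZMod L × ZMod L) q, σ ∉ PottsTorus.groundStates _ q →
        (PottsTorus.commHeightSet (PottsTorus.squareLattice L) σ
            (PottsTorus.groundStates _ q) : ℤ)
          - (PottsTorus.hamiltonian (PottsTorus.squareLattice L) σ : ℤ) < 2 * (L : ℤ) + 2) ∧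
    ((∀ a b : Fin q, a ≠ b →
        PottsTorus.commHeight (PottsTorus.hexLattice L)
          (PottsTorus.ground _ a) (PottsTorus.ground _ b) = 2 * L + 2) ∧
      ∀ σ : PottsTorus.Config (PottsTorus.HexSite L) q, σ ∉ PottsTorus.groundStates _ q →
        (PottsTorus.commHeightSet (PottsTorus.hexLattice L) σ
            (PottsTorus.groundStates _ q) : ℤ)
          - (PottsTorus.hamiltonian (PottsTorus.hexLattice L) σ : ℤ) < 2 * (L : ℤ) + 2) := by
  exact ⟨by exact_mod_cast PottsTorus.square_barrier (by omega) q,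
    by exact_mod_cast PottsTorus.hex_barrier (by omega) q⟩
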